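/- **The $Z_q$-forcing game.** Let $G=(V,E)$ be a finite simple graph and $q\ge 0$ an integer. All vertices are initially white. There are two players, Blue (who has tokens) and White. Blue repeatedly applies one of the following rules until all vertices are blue. 1. For one token, Blue changes any vertex from white to blue. 2. At no cost, if a blue vertex $v$ of $G$ has exactly one white neighbour $w$, then Blue may turn $w$ blue. 3. Let $B$ be the set of blue vertices and let $W_1,\dots,W_m$ be the vertex sets of the connected components of $G[V\setminus B]$. Blue selects at least $q+1$ of the $W_i$ and announces the selection to White. White then selects a nonempty subset $\{W_{i_1},\dots,W_{i_\ell}\}$ of these components and announces it back to Blue. At no cost, Blue may apply Rule 2 once in the induced subgraph $G[B\cup W_{i_1}\cup\dots\cup W_{i_\ell}]$. The $Z_q$-forcing number $\operatorname{Z}_q(G)$ is the least $t$ such that Blue has a strategy which, however White plays, colours all of $G$ blue in finitely many moves while spending at most $t$ tokens. **Theorem.** Let $k\ge 2$ and $n\ge 3$ be integers, and let $C_{n,k}$ be any graph obtained from the cycle $C_n$ by attaching to each vertex of $C_n$ at least $2$ and at most $k$ pendant vertices (the number may vary from vertex to vertex). Then $$\log_2(n)+1\;\le\;\operatorname{Z}_2(C_{n,k})\;\le\;\log_2(n-2)+2k+1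 .$$ -/

import Mathlib

namespace QForcing

universe u

variable {V : Type u}

/-- `Forces G X B v w`: with blue set `B`, the blue vertex `v` has exactly one white neighbour,
namely `w`, in the induced subgraph `G[X]` (it is applied with `B ⊆ X`). -/
def Forces (G : SimpleGraph V) (X B : Set V) (v w : V) : Prop :=
  v ∈ B ∧ w ∈ X \ B ∧ G.Adj v w ∧ ∀ x ∈ X \ B, G.Adj v x → x = w

/-- The connected components of `G[V \ B]`, where `B` is the blue set. -/
abbrev WhiteComponent (G : SimpleGraph V) (B : Set V) : Type u :=
  (G.induce Bᶜ).ConnectedComponent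

/-- The set of vertices of `G` lying in one of the white components in `S`. -/
def unionVerts (G : SimpleGraph V) (B : Set V) (S : Set (WhiteComponent G B)) : Set V :=
  {x | ∃ h : x ∈ Bᶜ, (G.induce Bᶜ).connectedComponentMk ⟨x, h⟩ ∈ S}

/-- `BlueWins G q B t`: in the `Z_q`-forcing game on `G` with current blue set `B`, Blue has a
strategy that, however White plays, colours all vertices blue after finitely many moves
while spending at most `t` further tokens. -/
inductive BlueWins (G : SimpleGraph V) (q : ℕ) : Set V → ℕ → Prop
  /-- All vertices are blue. -/
  | done (t : ℕ) : BlueWins G q Set.univ t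
  /-- Rule 1: for one token, colour any white vertex blue. -/
  | token (B : Set V) (t : ℕ) (v : V) (hv : v ∉ B)
      (next : BlueWins G q (insert v B) t) : BlueWins G q B (t + 1)
  /-- Rule 2: at no cost, a blue vertex with exactly one white neighbour colours it blue. -/
  | force (B : Set V) (t : ℕ) (v w : V) (hvw : Forces G Set.univ B v w)
      (next : BlueWins G q (insert w B) t) : BlueWins G q B t
  /-- Rule 3: Blue announces a set `W` of at least `q + 1` white components. White answers with a
  nonempty `S ⊆ W`. Then, at no cost, Blue may apply Rule 2 once in `G[B ∪ ⋃ S]`. Here `r S` is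
  the blue set after Blue's reaction to the answer `S`. -/
  | select (B : Set V) (t : ℕ) (W : Set (WhiteComponent G B)) (hW : (q : ℕ∞) + 1 ≤ W.encard)
      (r : Set (WhiteComponent G B) → Set V)
      (hr : ∀ S, S ⊆ W → S.Nonempty →
        r S = B ∨ ∃ v w, Forces G (B ∪ unionVerts G B S) B v w ∧ r S = insert w B)
      (next : ∀ S, S ⊆ W → S.Nonempty → BlueWins G q (r S) t) : BlueWins G q B t

/-- The `Z_q`-forcing number of a finite graph: the least number of tokens with which Blue can
guarantee to colour all vertices blue, starting from all vertices white. -/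
noncomputable def forcingNumber (G : SimpleGraph V) (q : ℕ) : ℕ :=
  sInf {t : ℕ | BlueWins G q ∅ t}

/-- The graph obtained from the cycle on the vertices `0, …, n - 1` by attaching `d i` pendant
vertices to the cycle vertex `i`. The cycle vertices are `Sum.inl i`, and the pendant
vertices at `i` are `Sum.inr ⟨i, j⟩` with `j < d i`. -/
def caterpillarCycle (n : ℕ) (d : Fin n → ℕ) : SimpleGraph (Fin n ⊕ (Σ i : Fin n, Fin (d i))) where
  Adj
    | .inl i, .inl j => (SimpleGraph.cycleGraph n).Adj i j
    | .inl i, .inr l => l.1 = i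
    | .inr l, .inl i => l.1 = i
    | .inr _, .inr _ => False
  symm := ⟨by
    rintro (i | l) (j | m) h
    · exact SimpleGraph.Adj.symm h
    · exact h
    · exact h
    · exact h⟩
  loopless := ⟨by
    rintro (i | l) h
    · exact (SimpleGraph.cycleGraph n).loopless.irrefl i h
    · exact h⟩

end QForcing

/-! Lower bound. White protects a fort from every free move: if some selected component misses the
fort, he answers with it alone; otherwise the selection is exactly the set of components meeting the
fort, and he returns all of it (`IsFort.exists_answer`). For `q = 2` the typical fort is an arc of
the cycle with all its pendants, together with one pendant at each of the two cycle vertices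
bounding the arc. Since every cycle vertex has two pendants, a token only roughly halves the arc
(`WhiteFort.step`). The first token merely opens the cycle, which accounts for the `+ 1`.

Upper bound. Three tokens leave two short white arcs on the cycle. While both are nonempty, Blue
moves for free by selecting both arcs and a white pendant at a blue cycle vertex
(`TwoArcs.progress`). When one arc is used up, a token in the middle of the other restores the
situation at half the length (`TwoArcs.blueWins`). Once the cycle is blue, pendants at three
different centres allow a free move, and pendants at two centres cost at most `2 * (k - 1)` tokens
(`blueWins_of_cycle_blue`). -/

namespace QForcing

/-! ### Forts and the defence of White -/

section Fort

variable {V : Type*} {G : SimpleGraph V} {q : ℕ}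

/-- A set `P` of vertices which White can keep white during the free moves of the `Z_q`-forcing
game: no vertex outside `P` has exactly one neighbour in `P`, and `P` induces at most `q + 1`
connected components, represented by the elements of `R`. -/
structure IsFort (G : SimpleGraph V) (q : ℕ) (P : Set V) : Prop where
  nonempty : P.Nonempty
  two_neighbours : ∀ v ∉ P, ∀ w ∈ P, G.Adj v w → ∃ w' ∈ P, w' ≠ w ∧ G.Adj v w'
  few_components : ∃ R : Set V, R.encard ≤ (q : ℕ∞) + 1 ∧ ∀ y (hy : y ∈ P), ∃ r ∈ R,
    ∃ hr : r ∈ P, (G.induce P).Reachable ⟨r, hr⟩ ⟨y, hy⟩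

theorem IsFort.not_forces {P X B : Set V} (hP : IsFort G q P) (hB : Disjoint B P) (hX : P ⊆ X)
    {v w : V} (h : Forces G X B v w) : w ∉ P := by
  intro hw
  obtain ⟨hv, -, hvw, huniq⟩ := h
  obtain ⟨w', hw', hne, hadj⟩ :=
    hP.two_neighbours v (Set.disjoint_left.1 hB hv) w hw hvw
  exact hne (huniq w' ⟨hX hw', fun h => Set.disjoint_left.1 hB h hw'⟩ hadj)

/-- Whatever components Blue announces, White has an answer that protects the fort `P`. -/
theorem IsFort.exists_answer {P B : Set V} (hP : IsFort G q P) (hB : Disjoint B P)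
    (W : Set (WhiteComponent G B)) (hW : (q : ℕ∞) + 1 ≤ W.encard) :
    ∃ S ⊆ W, S.Nonempty ∧ ∀ v w, Forces G (B ∪ unionVerts G B S) B v w → w ∉ P := by
  have hPB : P ⊆ Bᶜ := fun x hx h => Set.disjoint_left.1 hB h hx
  by_cases hz : ∃ z ∈ W, ∀ x (h : x ∈ P), (G.induce Bᶜ).connectedComponentMk ⟨x, hPB h⟩ ≠ z
  · obtain ⟨z, hzW, hz⟩ := hz
    -- The component `z` misses `P`, so no vertex of `P` is visible to Blue.
    refine ⟨{z}, by simpa using hzW, Set.singleton_nonempty z, fun v w h hw => ?_⟩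
    obtain ⟨-, ⟨hX, hwB⟩, -⟩ := h
    rcases hX with h | ⟨h, h'⟩
    · exact hwB h
    · exact hz w hw h'
  · push Not at hz
    have hne : W.Nonempty := by
      rw [← Set.encard_pos]
      exact lt_of_lt_of_le (by simp) hW
    refine ⟨W, subset_rfl, hne, fun v w h => hP.not_forces hB ?_ h⟩
    obtain ⟨R, hR, hreach⟩ := hP.few_components
    -- `M` contains every component meeting `P` and has at most `q + 1` elements. All of `W` meets
    -- `P`, so counting forces `W = M`, and then all of `P` is visible.
    let M : Set (WhiteComponent G B) :=
      (fun r => (G.induce Bᶜ).connectedComponentMk r) '' (Subtype.val ⁻¹' R)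
    have hmem : ∀ x (h : x ∈ P), (G.induce Bᶜ).connectedComponentMk ⟨x, hPB h⟩ ∈ M := by
      intro x hx
      obtain ⟨r, hrR, hrP, hrx⟩ := hreach x hx
      refine ⟨⟨r, hPB hrP⟩, hrR, ?_⟩
      exact SimpleGraph.ConnectedComponent.sound
        (hrx.map (SimpleGraph.induceHomOfLE G hPB).toHom)
    have hMR : M.encard ≤ R.encard :=
      (Set.encard_image_le _ _).trans (by
        rw [← Set.InjOn.encard_image (Subtype.val_injective.injOn)]
        exact Set.encard_le_encard (by simp))
    have hWM : W ⊆ M := by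
      intro z hzW
      obtain ⟨x, hx, rfl⟩ := hz z hzW
      exact hmem x hx
    have hfin : M.Finite := by
      apply Set.finite_of_encard_le_coe (k := q + 1)
      push_cast
      exact hMR.trans hR
    have hEq : W = M := (hfin.subset hWM).eq_of_subset_of_encard_le hWM ((hMR.trans hR).trans hW)
    intro x hx
    right
    exact ⟨hPB hx, hEq ▸ hmem x hx⟩

/-- White wins against `t` tokens if he always has a smaller fort at hand after a token was
spent. -/
theorem not_blueWins_of_forts (F : ℕ → Set (Set V)) (hfort : ∀ t, ∀ P ∈ F t, IsFort G q P)
    (hstep : ∀ t, ∀ P ∈ F (t + 1), ∀ v, ∃ P' ∈ F t, P' ⊆ P ∧ v ∉ P') {B : Set V} {t : ℕ}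
    {P : Set V} (hP : P ∈ F t) (hB : Disjoint B P) : ¬ BlueWins G q B t := by
  intro h
  induction h generalizing P with
  | done t =>
    obtain ⟨x, hx⟩ := (hfort t P hP).nonempty
    exact Set.disjoint_left.1 hB (Set.mem_univ x) hx
  | token B t v hv next ih =>
    obtain ⟨P', hP', hsub, hvP⟩ := hstep t P hP v
    exact ih hP' (Set.disjoint_insert_left.2 ⟨hvP, hB.mono_right hsub⟩)
  | force B t v w hvw next ih =>
    exact ih hP (Set.disjoint_insert_left.2
      ⟨(hfort t P hP).not_forces hB (Set.subset_univ P) hvw, hB⟩)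
  | select B t W hW r hr next ih =>
    obtain ⟨S, hSW, hS, hprot⟩ := (hfort t P hP).exists_answer hB W hW
    refine ih S hSW hS hP ?_
    rcases hr S hSW hS with h | ⟨v, w, hvw, h⟩
    · rwa [h]
    · rw [h]
      exact Set.disjoint_insert_left.2 ⟨hprot v w hvw, hB⟩

end Fort

/-! ### Coordinates on the cycle -/

section Coordinates

variable {n : ℕ} [NeZero n]

/-- The cycle vertex with index `i` modulo `n`. -/
def vtx (n : ℕ) [NeZero n] (i : ℕ) : Fin n := Fin.ofNat n i

theorem vtx_eq_vtx {i j : ℕ} : vtx n i = vtx n j ↔ i ≡ j [MOD n] := by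
  simp [vtx, Fin.ext_iff, Nat.ModEq]

theorem vtx_add_inj {s i j : ℕ} (hi : i < n) (hj : j < n) :
    vtx n (s + i) = vtx n (s + j) ↔ i = j := by
  rw [vtx_eq_vtx]
  constructor
  · intro h
    have := Nat.ModEq.add_left_cancel' s h
    rwa [Nat.ModEq, Nat.mod_eq_of_lt hi, Nat.mod_eq_of_lt hj] at this
  · rintro rfl; rfl

theorem vtx_add_self (i : ℕ) : vtx n (i + n) = vtx n i := by
  simp [vtx_eq_vtx, Nat.ModEq]

theorem exists_vtx (s : ℕ) (x : Fin n) : ∃ j < n, x = vtx n (s + j) := by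
  have hn := Nat.pos_of_neZero n
  refine ⟨(x.val + (n - s % n)) % n, Nat.mod_lt _ hn, ?_⟩
  have hs := Nat.mod_lt s hn
  have h : vtx n (s + (x.val + (n - s % n)) % n) = vtx n x.val := by
    rw [vtx_eq_vtx]
    calc s + (x.val + (n - s % n)) % n ≡ s % n + (x.val + (n - s % n)) [MOD n] :=
          Nat.ModEq.add (Nat.mod_modEq s n).symm (Nat.mod_modEq _ n)
      _ = x.val + n := by omega
      _ ≡ x.val [MOD n] := by simp [Nat.ModEq]
  rw [h]
  ext
  simp [vtx]

theorem cycleGraph_adj_vtx (hn : 3 ≤ n) {s i j : ℕ} (hi : i < n) (hj : j < n) :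
    (SimpleGraph.cycleGraph n).Adj (vtx n (s + i)) (vtx n (s + j)) ↔
      (j = i + 1 ∨ i = j + 1 ∨ (i = 0 ∧ j + 1 = n) ∨ (j = 0 ∧ i + 1 = n)) := by
  obtain ⟨m, rfl⟩ : ∃ m, n = m + 2 := ⟨n - 2, by omega⟩
  have key : ∀ i j : ℕ, i < m + 2 → j < m + 2 → (vtx (m + 2) (s + j) = vtx (m + 2) (s + i) + 1 ↔
      (j = i + 1 ∨ (j = 0 ∧ i + 1 = m + 2))) := by
    intro i j hi hj
    have h1 : vtx (m + 2) (s + i) + 1 = vtx (m + 2) (s + (i + 1)) := by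
      ext
      simp [vtx, Fin.val_add, add_assoc]
    rw [h1]
    by_cases h : i + 1 < m + 2
    · rw [vtx_add_inj hj h]; omega
    · have : i + 1 = 0 + (m + 2) := by omega
      rw [this, ← add_assoc, vtx_add_self, vtx_add_inj hj (by omega)]
      omega
  rw [SimpleGraph.cycleGraph_adj, sub_eq_iff_eq_add, sub_eq_iff_eq_add, add_comm 1, add_comm 1,
    key _ _ hj hi, key _ _ hi hj]
  omega

end Coordinates


/-! ### White's forts on the caterpillar cycle -/

section Caterpillar

variable {n : ℕ} {d : Fin n → ℕ}

/-- The cycle vertex at which a vertex of the caterpillar cycle sits. -/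
def centre (v : Fin n ⊕ (Σ i : Fin n, Fin (d i))) : Fin n := Sum.elim id Sigma.fst v

@[simp] theorem centre_inl (i : Fin n) :
    centre (Sum.inl i : Fin n ⊕ (Σ i : Fin n, Fin (d i))) = i := rfl

@[simp] theorem centre_inr (l : Σ i : Fin n, Fin (d i)) :
    centre (Sum.inr l : Fin n ⊕ (Σ i : Fin n, Fin (d i))) = l.1 := rfl

@[simp] theorem adj_inl_inl {i j : Fin n} : (caterpillarCycle n d).Adj (.inl i) (.inl j) ↔
    (SimpleGraph.cycleGraph n).Adj i j := Iff.rfl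

@[simp] theorem adj_inl_inr {i : Fin n} {l} : (caterpillarCycle n d).Adj (.inl i) (.inr l) ↔
    l.1 = i := Iff.rfl

@[simp] theorem adj_inr_inl {i : Fin n} {l} : (caterpillarCycle n d).Adj (.inr l) (.inl i) ↔
    l.1 = i := Iff.rfl

@[simp] theorem not_adj_inr_inr {l m} : ¬ (caterpillarCycle n d).Adj (.inr l) (.inr m) := id

theorem exists_pendant_ne (hd : ∀ i, 2 ≤ d i) (i : Fin n)
    (v : Fin n ⊕ (Σ i : Fin n, Fin (d i))) :
    ∃ l : Σ i : Fin n, Fin (d i), l.1 = i ∧ v ≠ .inr l := by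
  have h := hd i
  by_cases hv : v = .inr ⟨i, ⟨0, by omega⟩⟩
  · refine ⟨⟨i, ⟨1, by omega⟩⟩, rfl, ?_⟩
    rw [hv]
    simp
  · exact ⟨_, rfl, hv⟩

variable [NeZero n]

theorem reachable_path (hn : 3 ≤ n) {P : Set (Fin n ⊕ (Σ i : Fin n, Fin (d i)))} {s L : ℕ}
    (hP : ∀ j ≤ L, Sum.inl (vtx n (s + j)) ∈ P) {j : ℕ} (hj : j ≤ L) :
    ((caterpillarCycle n d).induce P).Reachable ⟨.inl (vtx n s), hP 0 (Nat.zero_le L)⟩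
      ⟨.inl (vtx n (s + j)), hP j hj⟩ := by
  induction j with
  | zero => exact SimpleGraph.Reachable.refl _
  | succ j ih =>
    refine (ih (by omega)).trans (SimpleGraph.Adj.reachable ?_)
    have := (cycleGraph_adj_vtx hn (s := s + j) (i := 0) (j := 1) (by omega) (by omega)).2
      (by simp)
    simpa [← add_assoc] using this

/-- The cycle vertices with offsets `1, …, L` from `s`, all their pendant vertices, and `T`. -/
def arcSet (d : Fin n → ℕ) (s L : ℕ) (T : Set (Fin n ⊕ (Σ i : Fin n, Fin (d i)))) :
    Set (Fin n ⊕ (Σ i : Fin n, Fin (d i))) :=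
  {v | ∃ j, 1 ≤ j ∧ j ≤ L ∧ centre v = vtx n (s + j)} ∪ T

/-- The arc with its pendants is connected, so its first cycle vertex represents it; each element of
`T` represents itself. -/
theorem arcSet_few_components (hn : 3 ≤ n) {s L : ℕ} (hL : 1 ≤ L)
    {T : Set (Fin n ⊕ (Σ i : Fin n, Fin (d i)))} (hT : T.encard ≤ 2) :
    ∃ R : Set (Fin n ⊕ (Σ i : Fin n, Fin (d i))), R.encard ≤ ((2 : ℕ) : ℕ∞) + 1 ∧
      ∀ y (hy : y ∈ arcSet d s L T), ∃ r ∈ R, ∃ hr : r ∈ arcSet d s L T,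
        ((caterpillarCycle n d).induce (arcSet d s L T)).Reachable ⟨r, hr⟩ ⟨y, hy⟩ := by
  have hmem : ∀ j ≤ L - 1, Sum.inl (vtx n (s + 1 + j)) ∈ arcSet d s L T := fun j hj =>
    Or.inl ⟨1 + j, by omega, by omega, by simp [add_assoc]⟩
  refine ⟨insert (.inl (vtx n (s + 1))) T, ?_, ?_⟩
  · exact (Set.encard_insert_le _ _).trans (by simpa using hT)
  · intro y hy
    by_cases hyT : y ∈ T
    · exact ⟨y, Or.inr hyT, hy, SimpleGraph.Reachable.refl _⟩
    obtain ⟨j, hj1, hjL, hc⟩ : ∃ j, 1 ≤ j ∧ j ≤ L ∧ centre y = vtx n (s + j) :=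
      hy.resolve_right hyT
    obtain ⟨i, rfl⟩ : ∃ i, j = 1 + i := ⟨j - 1, by omega⟩
    refine ⟨_, Or.inl rfl, hmem 0 (Nat.zero_le _), ?_⟩
    have h := reachable_path hn hmem (j := i) (by omega)
    rw [← add_assoc] at hc
    rcases y with y | l
    · simp only [centre_inl] at hc
      subst hc
      exact h
    · refine h.trans (SimpleGraph.Adj.reachable ?_)
      simpa using hc

/-- Only the bounding cycle vertices, at offsets `0` and `L + 1`, see the set from outside. Each
sees an end of the arc as well as its own pendant `p` or `q`. -/
theorem isFort_arc (hn : 3 ≤ n) {s L : ℕ} (hL : 1 ≤ L) (hLn : L + 2 ≤ n)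
    {p q : Σ i : Fin n, Fin (d i)} (hp : p.1 = vtx n s) (hq : q.1 = vtx n (s + (L + 1))) :
    IsFort (caterpillarCycle n d) 2 (arcSet d s L {.inr p, .inr q}) where
  nonempty := ⟨.inr p, Or.inr (by simp)⟩
  few_components := arcSet_few_components hn hL ((Set.encard_insert_le _ _).trans (by simp [one_add_one_eq_two]))
  two_neighbours := by
    have hstart : ∀ i, i < n → (vtx n (s + i) = vtx n s ↔ i = 0) := fun i hi => by
      simpa using vtx_add_inj (s := s) hi (j := 0) (by omega)
    have hmem : ∀ j, 1 ≤ j → j ≤ L → Sum.inl (vtx n (s + j)) ∈ arcSet d s L {.inr p, .inr q} :=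
      fun j h1 h2 => Or.inl ⟨j, h1, h2, rfl⟩
    have hadj : ∀ i j, i < n → j < n → _ := fun i j hi hj => cycleGraph_adj_vtx hn (s := s) hi hj
    rintro v hv w hw hvw
    rcases v with x | l
    · obtain ⟨i, hi, rfl⟩ := exists_vtx s x
      have hi' : ¬ (1 ≤ i ∧ i ≤ L) := fun h => hv (hmem i h.1 h.2)
      have hends : i = 0 ∨ i = L + 1 := by
        rcases hw with ⟨j, h1, h2, hc⟩ | hw
        · rcases w with y | l
          · simp only [centre_inl] at hc
            subst hc
            have := (hadj i j hi (by omega)).1 hvw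
            omega
          · rw [centre_inr, show l.1 = _ from hvw, vtx_add_inj hi (by omega)] at hc
            omega
        · rcases hw with rfl | rfl
          · left
            rw [adj_inl_inr, hp, eq_comm, hstart i hi] at hvw
            exact hvw
          · right
            rw [adj_inl_inr, hq, eq_comm, vtx_add_inj hi (by omega)] at hvw
            exact hvw
      rcases hends with rfl | rfl
      · rcases w with y | l
        · exact ⟨.inr p, Or.inr (by simp), by simp, by simpa using hp⟩
        · exact ⟨.inl (vtx n (s + 1)), hmem 1 le_rfl hL, by simp,
            (hadj 0 1 hi (by omega)).2 (by omega)⟩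
      · rcases w with y | l
        · exact ⟨.inr q, Or.inr (by simp), by simp, by simpa using hq⟩
        · exact ⟨.inl (vtx n (s + L)), hmem L hL le_rfl, by simp,
            (hadj (L + 1) L hi (by omega)).2 (by omega)⟩
    · rcases w with y | m
      · rcases hw with ⟨j, h1, h2, hc⟩ | hw
        · exact absurd (Or.inl ⟨j, h1, h2, (show l.1 = y from hvw).trans hc⟩) hv
        · simp at hw
      · exact absurd hvw not_adj_inr_inr

/-- Only the cycle vertex `s` can see the set from outside, and it sees both its cycle neighbours,
which are distinct as `n ≥ 3`. -/
theorem isFort_punctured (hn : 3 ≤ n) {s : ℕ} {T : Set (Fin n ⊕ (Σ i : Fin n, Fin (d i)))}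
    (hT : T.encard ≤ 2) (hT' : ∀ i, Sum.inl i ∉ T) :
    IsFort (caterpillarCycle n d) 2 (arcSet d s (n - 1) T) where
  nonempty := ⟨.inl (vtx n (s + 1)), Or.inl ⟨1, le_rfl, by omega, rfl⟩⟩
  few_components := arcSet_few_components hn (by omega) hT
  two_neighbours := by
    have hmem : ∀ j, 1 ≤ j → j ≤ n - 1 → Sum.inl (vtx n (s + j)) ∈ arcSet d s (n - 1) T :=
      fun j h1 h2 => Or.inl ⟨j, h1, h2, rfl⟩
    have hadj : ∀ i j, i < n → j < n → _ := fun i j hi hj => cycleGraph_adj_vtx hn (s := s) hi hj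
    rintro v hv w hw hvw
    rcases v with x | l
    · obtain ⟨i, hi, rfl⟩ := exists_vtx s x
      have hi' : ¬ (1 ≤ i ∧ i ≤ n - 1) := fun h => hv (hmem i h.1 h.2)
      obtain rfl : i = 0 := by omega
      by_cases hw1 : w = .inl (vtx n (s + 1))
      · refine ⟨.inl (vtx n (s + (n - 1))), hmem _ (by omega) le_rfl, ?_,
          (hadj 0 (n - 1) hi (by omega)).2 (by omega)⟩
        rw [hw1, Ne, Sum.inl.injEq, vtx_add_inj (by omega) (by omega)]
        omega
      · exact ⟨.inl (vtx n (s + 1)), hmem _ (by omega) (by omega), Ne.symm hw1,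
          (hadj 0 1 hi (by omega)).2 (by omega)⟩
    · rcases w with y | m
      · rcases hw with ⟨j, h1, h2, hc⟩ | hw
        · exact absurd (Or.inl ⟨j, h1, h2, (show l.1 = y from hvw).trans hc⟩) hv
        · exact absurd hw (hT' y)
      · exact absurd hvw not_adj_inr_inr

theorem arcSet_eq_univ (s : ℕ) : arcSet d s n ∅ = Set.univ := by
  refine Set.eq_univ_of_forall fun v => Or.inl ?_
  obtain ⟨j, hj, h⟩ := exists_vtx (s + 1) (centre v)
  exact ⟨1 + j, by omega, by omega, by rw [h, add_assoc]⟩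

theorem isFort_univ (hn : 3 ≤ n) :
    IsFort (caterpillarCycle n d) 2 (Set.univ : Set (Fin n ⊕ (Σ i : Fin n, Fin (d i)))) where
  nonempty := ⟨.inl (vtx n 0), trivial⟩
  few_components := by
    rw [← arcSet_eq_univ 0]
    exact arcSet_few_components hn (by omega) (by simp)
  two_neighbours := fun v hv => absurd (Set.mem_univ v) hv

/-- The forts with which White resists `t` tokens. -/
inductive WhiteFort (d : Fin n → ℕ) : ℕ → Set (Fin n ⊕ (Σ i : Fin n, Fin (d i))) → Prop
  | arc (t s L : ℕ) (p q : Σ i : Fin n, Fin (d i)) (hLn : L + 2 ≤ n) (hL : 2 ^ t ≤ L)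
      (hp : p.1 = vtx n s) (hq : q.1 = vtx n (s + (L + 1))) :
      WhiteFort d t (arcSet d s L {.inr p, .inr q})
  | punctured (t s : ℕ) (p : Σ i : Fin n, Fin (d i)) (ht : 2 ^ t ≤ n - 1) (hp : p.1 = vtx n s) :
      WhiteFort d t (arcSet d s (n - 1) {.inr p})
  | bare (s : ℕ) : WhiteFort d 0 (arcSet d s (n - 1) ∅)
  | zero : WhiteFort d 0 Set.univ
  | univ (t : ℕ) (ht : 2 ^ t ≤ n - 1) : WhiteFort d (t + 1) Set.univ

theorem WhiteFort.isFort (hn : 3 ≤ n) {t : ℕ} {P : Set (Fin n ⊕ (Σ i : Fin n, Fin (d i)))}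
    (h : WhiteFort d t P) : IsFort (caterpillarCycle n d) 2 P := by
  cases h with
  | arc _ s L p q hLn hL hp hq => exact isFort_arc hn (Nat.one_le_two_pow.trans hL) hLn hp hq
  | punctured _ s p ht hp =>
    exact isFort_punctured hn (by simp) (by simp)
  | bare s => exact isFort_punctured hn (by simp) (by simp)
  | zero => exact isFort_univ hn
  | univ t ht => exact isFort_univ hn

theorem arcSet_subset {s L a L' : ℕ} {T T' : Set (Fin n ⊕ (Σ i : Fin n, Fin (d i)))}
    (h : a + L' ≤ L) (hT : T' ⊆ arcSet d s L T) : arcSet d (s + a) L' T' ⊆ arcSet d s L T := by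
  rintro v (⟨j, h1, h2, hc⟩ | hv)
  · exact Or.inl ⟨a + j, by omega, by omega, by rw [hc, add_assoc]⟩
  · exact hT hv

theorem mem_arcSet_of_centre {s L j : ℕ} {T : Set (Fin n ⊕ (Σ i : Fin n, Fin (d i)))}
    {v : Fin n ⊕ (Σ i : Fin n, Fin (d i))} (hj1 : 1 ≤ j) (hjL : j ≤ L)
    (hc : centre v = vtx n (s + j)) : v ∈ arcSet d s L T := Or.inl ⟨j, hj1, hjL, hc⟩

theorem notMem_arcSet {s a L j : ℕ} {T : Set (Fin n ⊕ (Σ i : Fin n, Fin (d i)))}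
    {v : Fin n ⊕ (Σ i : Fin n, Fin (d i))} (hv : centre v = vtx n (s + j)) (hj : j < n)
    (ha : a + L < n) (hja : j ≤ a ∨ a + L < j) (hT : v ∉ T) : v ∉ arcSet d (s + a) L T := by
  rintro (⟨i, h1, h2, hc⟩ | h)
  · rw [hv, add_assoc, vtx_add_inj hj (by omega)] at hc
    omega
  · exact hT h

/-- A token at or next to an arc vertex splits the arc there. That vertex becomes a new boundary,
and one of its at least two pendants is still free to complete the smaller fort. -/
theorem WhiteFort.step (hn : 3 ≤ n) (hd : ∀ i, 2 ≤ d i) {t : ℕ}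
    {P : Set (Fin n ⊕ (Σ i : Fin n, Fin (d i)))} (h : WhiteFort d (t + 1) P)
    (v : Fin n ⊕ (Σ i : Fin n, Fin (d i))) : ∃ P', WhiteFort d t P' ∧ P' ⊆ P ∧ v ∉ P' := by
  have hpow : 2 ^ (t + 1) = 2 * 2 ^ t := by ring
  have hpos : 1 ≤ 2 ^ t := Nat.one_le_two_pow
  cases h with
  | arc _ s L p q hLn hL hp hq =>
    obtain ⟨j, hj, hv⟩ := exists_vtx s (centre v)
    by_cases hjL : 1 ≤ j ∧ j ≤ L
    · obtain ⟨x, hx, hvx⟩ := exists_pendant_ne hd (vtx n (s + j)) v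
      have hxP : Sum.inr x ∈ arcSet d s L {.inr p, .inr q} := mem_arcSet_of_centre hjL.1 hjL.2 hx
      -- The two pieces have lengths `j - 1` and `L - j`, with sum `L - 1 ≥ 2 * 2 ^ t - 1`, so one
      -- of them is long enough.
      by_cases hlen : 2 ^ t ≤ j - 1
      · refine ⟨_, .arc t s (j - 1) p x (by omega) hlen hp
          (by rw [hx]; congr 1; omega), ?_, ?_⟩
        · refine arcSet_subset (a := 0) (by omega) ?_
          rintro y (rfl | rfl)
          · exact Or.inr (by simp)
          · exact hxP
        · refine notMem_arcSet (a := 0) hv hj (by omega) (by omega) ?_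
          rintro (rfl | h)
          · rw [centre_inr, hp, ← add_zero s, add_assoc, vtx_add_inj (by omega) (by omega)] at hv
            omega
          · exact hvx h
      · refine ⟨_, .arc t (s + j) (L - j) x q (by omega) (by omega) hx
          (by rw [hq]; congr 1; omega), ?_, ?_⟩
        · refine arcSet_subset (by omega) ?_
          rintro y (rfl | rfl)
          · exact hxP
          · exact Or.inr (by simp)
        · refine notMem_arcSet hv hj (by omega) (by omega) ?_
          rintro (h | rfl)
          · exact hvx h
          · rw [centre_inr, hq, vtx_add_inj (by omega) (by omega)] at hv
            omega
    -- If the token takes a boundary pendant, the arc gives up its end vertex as the new boundary;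
    -- `2 ^ (t + 1) - 1 ≥ 2 ^ t` allows this.
    by_cases hvp : v = .inr p
    · subst hvp
      obtain ⟨x, hx, hvx⟩ := exists_pendant_ne hd (vtx n (s + 1)) (.inr p)
      refine ⟨_, .arc t (s + 1) (L - 1) x q (by omega) (by omega) hx
        (by rw [hq]; congr 1; omega), ?_, ?_⟩
      · refine arcSet_subset (by omega) ?_
        rintro y (rfl | rfl)
        · exact mem_arcSet_of_centre le_rfl (by omega) hx
        · exact Or.inr (by simp)
      · refine notMem_arcSet hv hj (by omega) (by omega) ?_
        rintro (h | h)
        · exact hvx h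
        · obtain rfl : p = q := by simpa using h
          rw [hq, ← add_zero s, add_assoc, vtx_add_inj (by omega) (by omega)] at hp
          omega
    by_cases hvq : v = .inr q
    · subst hvq
      obtain ⟨x, hx, hvx⟩ := exists_pendant_ne hd (vtx n (s + L)) (.inr q)
      refine ⟨_, .arc t s (L - 1) p x (by omega) (by omega) hp
        (by rw [hx]; congr 1; omega), ?_, ?_⟩
      · refine arcSet_subset (a := 0) (by omega) ?_
        rintro y (rfl | rfl)
        · exact Or.inr (by simp)
        · exact mem_arcSet_of_centre (by omega) le_rfl hx
      · refine notMem_arcSet (a := 0) hv hj (by omega) (by omega) ?_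
        rintro (h | h)
        · exact hvp h
        · exact hvx h
    · refine ⟨_, .arc t s L p q hLn (by omega) hp hq, subset_rfl, ?_⟩
      refine notMem_arcSet (a := 0) hv hj (by omega) (by omega) ?_
      rintro (h | h)
      · exact hvp h
      · exact hvq h
  | punctured _ s p ht hp =>
    obtain ⟨j, hj, hv⟩ := exists_vtx s (centre v)
    by_cases hjL : 1 ≤ j
    · obtain ⟨x, hx, hvx⟩ := exists_pendant_ne hd (vtx n (s + j)) v
      have hxP : Sum.inr x ∈ arcSet d s (n - 1) {.inr p} :=
        mem_arcSet_of_centre hjL (by omega) hx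
      have hvp : v ≠ .inr p := by
        rintro rfl
        rw [centre_inr, hp, ← add_zero s, add_assoc, vtx_add_inj (by omega) (by omega)] at hv
        omega
      by_cases hlen : 2 ^ t ≤ j - 1
      · refine ⟨_, .arc t s (j - 1) p x (by omega) hlen hp
          (by rw [hx]; congr 1; omega), ?_, ?_⟩
        · refine arcSet_subset (a := 0) (by omega) ?_
          rintro y (rfl | rfl)
          · exact Or.inr (by simp)
          · exact hxP
        · refine notMem_arcSet (a := 0) hv hj (by omega) (by omega) ?_
          rintro (h | h)
          · exact hvp h
          · exact hvx h
      · refine ⟨_, .arc t (s + j) (n - 1 - j) x p (by omega) (by omega) hx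
          (by rw [hp, ← vtx_add_self s]; congr 1; omega), ?_, ?_⟩
        · refine arcSet_subset (by omega) ?_
          rintro y (rfl | rfl)
          · exact hxP
          · exact Or.inr (by simp)
        · refine notMem_arcSet hv hj (by omega) (by omega) ?_
          rintro (h | h)
          · exact hvx h
          · exact hvp h
    obtain rfl : j = 0 := by omega
    by_cases hvp : v = .inr p
    · subst hvp
      -- Both ends of the arc must become boundary vertices, leaving length `n - 3`. This may be `0`
      -- when `t = 0`, hence the `bare` fort.
      rcases Nat.eq_zero_or_pos t with rfl | htpos
      · refine ⟨_, .bare s, ?_, ?_⟩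
        · exact arcSet_subset (a := 0) (by omega) (Set.empty_subset _)
        · exact notMem_arcSet (a := 0) hv hj (by omega) (by omega) (by simp)
      · have htwo : 2 ≤ 2 ^ t := Nat.le_self_pow htpos.ne' 2
        obtain ⟨x, hx, hvx⟩ := exists_pendant_ne hd (vtx n (s + 1)) (.inr p)
        obtain ⟨y, hy, hvy⟩ := exists_pendant_ne hd (vtx n (s + (n - 1))) (.inr p)
        refine ⟨_, .arc t (s + 1) (n - 3) x y (by omega) (by omega) hx
          (by rw [hy]; congr 1; omega), ?_, ?_⟩
        · refine arcSet_subset (by omega) ?_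
          rintro z (rfl | rfl)
          · exact mem_arcSet_of_centre le_rfl (by omega) hx
          · exact mem_arcSet_of_centre (by omega) le_rfl hy
        · refine notMem_arcSet hv hj (by omega) (by omega) ?_
          rintro (h | h)
          · exact hvx h
          · exact hvy h
    · exact ⟨_, .punctured t s p (by omega) hp, subset_rfl,
        notMem_arcSet (a := 0) hv hj (by omega) (by omega) hvp⟩
  | univ t ht =>
    obtain ⟨s, hs, hv⟩ := exists_vtx 0 (centre v)
    rw [zero_add] at hv
    obtain ⟨x, hx, hvx⟩ := exists_pendant_ne hd (vtx n s) v
    exact ⟨_, .punctured t s x ht hx, Set.subset_univ _,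
      notMem_arcSet (a := 0) (j := 0) hv (by omega) (by omega) (by omega) hvx⟩

theorem lt_of_blueWins_empty (hn : 3 ≤ n) (hd : ∀ i, 2 ≤ d i) {t : ℕ}
    (h : BlueWins (caterpillarCycle n d) 2 ∅ t) : ∃ t', t = t' + 1 ∧ n ≤ 2 ^ t' := by
  have key : ¬ WhiteFort d t Set.univ := fun hF =>
    not_blueWins_of_forts (fun t => {P | WhiteFort d t P}) (fun t P hP => WhiteFort.isFort hn hP)
      (fun t P hP v => WhiteFort.step hn hd hP v) hF (Set.disjoint_left.2 fun _ h => h.elim) h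
  cases t with
  | zero => exact absurd .zero key
  | succ t =>
    refine ⟨t, rfl, ?_⟩
    by_contra hlt
    exact key (.univ t (by omega))

end Caterpillar


/-! ### Strategies of Blue -/

section Selection

variable {V : Type*} {G : SimpleGraph V}

/-- Blue selects the components of three white vertices `y 0`, `y 1`, `y 2`, which are separated
by a labelling that is constant on white components. -/
theorem blueWins_of_three {B : Set V} {t : ℕ} {α : Type*} (lab : V → α)
    (hlab : ∀ x ∉ B, ∀ y ∉ B, G.Adj x y → lab x = lab y) (y : Fin 3 → V) (hy : ∀ i, y i ∉ B)
    (hinj : Function.Injective (lab ∘ y))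
    (hS : ∀ S : Set (Fin 3), S.Nonempty → ∃ i ∈ S, ∃ v ∈ B, ∃ w, ∃ hw : w ∉ B, G.Adj v w ∧
      (G.induce Bᶜ).Reachable ⟨y i, hy i⟩ ⟨w, hw⟩ ∧
      (∀ j ∈ S, ∀ x ∉ B, G.Adj v x → lab x = lab (y j) → x = w) ∧
      BlueWins G 2 (insert w B) t) : BlueWins G 2 B t := by
  have u_mem : ∀ x : (Bᶜ : Set V), (x : V) ∉ B := fun x => x.2
  have : Nonempty V := ⟨y 0⟩
  have hreach : ∀ x x' : (Bᶜ : Set V), (G.induce Bᶜ).Reachable x x' → lab x = lab x' := by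
    rintro x x' ⟨p⟩
    induction p with
    | nil => rfl
    | cons h p ih => exact (hlab _ (u_mem _) _ (u_mem _) h).trans ih
  let c : Fin 3 → WhiteComponent G B :=
    fun i => (G.induce Bᶜ).connectedComponentMk ⟨y i, hy i⟩
  have hc : Function.Injective c := fun i j h =>
    hinj (hreach _ _ (SimpleGraph.ConnectedComponent.exact h))
  have hT : ∀ S : Set (WhiteComponent G B), S ⊆ Set.range c → S.Nonempty →
      ∃ w, (∃ v, Forces G (B ∪ unionVerts G B S) B v w) ∧ BlueWins G 2 (insert w B) t := by
    intro S hSc hSne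
    obtain ⟨i, hi, v, hv, w, hw, hadj, hr, huniq, hwin⟩ := hS (c ⁻¹' S) (by
      obtain ⟨z, hz⟩ := hSne
      obtain ⟨i, rfl⟩ := hSc hz
      exact ⟨i, hz⟩)
    refine ⟨w, ⟨v, hv, ⟨Or.inr ⟨hw, ?_⟩, hw⟩, hadj, ?_⟩, hwin⟩
    · rw [← SimpleGraph.ConnectedComponent.sound hr]
      exact hi
    · rintro x ⟨hx | ⟨hxB, hxS⟩, hxB'⟩ hvx
      · exact absurd hx hxB'
      · obtain ⟨j, hj⟩ := hSc hxS
        refine huniq j (by rw [Set.mem_preimage, hj]; exact hxS) x hxB' hvx ?_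
        exact (hreach _ _ (SimpleGraph.ConnectedComponent.exact hj)).symm
  choose! f hf hwin using hT
  refine .select B t (Set.range c) ?_ (fun S => insert (f S) B) ?_ hwin
  · rw [← Set.image_univ, hc.encard_image, Set.encard_univ]
    simp
    norm_num
  · intro S h1 h2
    obtain ⟨v, hv⟩ := hf S h1 h2
    exact Or.inr ⟨v, f S, hv, rfl⟩

theorem ncard_compl_insert_lt [Finite V] {B : Set V} {w : V} (hw : w ∉ B) :
    (insert w B)ᶜ.ncard < Bᶜ.ncard :=
  Set.ncard_lt_ncard (compl_lt_compl_iff_lt.2 (Set.ssubset_insert hw)) (Set.toFinite _)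

end Selection

/-! ### Blue's strategy on the caterpillar cycle -/

section BlueStrategy

variable {n : ℕ} {d : Fin n → ℕ}

/-- The white pendant vertices at `z`. -/
def whitePendants (B : Set (Fin n ⊕ (Σ i : Fin n, Fin (d i)))) (z : Fin n) :
    Set (Σ i : Fin n, Fin (d i)) := {l | l.1 = z ∧ Sum.inr l ∉ B}

theorem ncard_whitePendants_le (B : Set (Fin n ⊕ (Σ i : Fin n, Fin (d i)))) (z : Fin n) :
    (whitePendants B z).ncard ≤ d z := by
  have hsub : whitePendants B z ⊆ Set.range (Sigma.mk z) := by
    rintro ⟨i, j⟩ ⟨h, -⟩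
    obtain rfl : i = z := h
    exact ⟨j, rfl⟩
  refine (Set.ncard_le_ncard hsub (Set.toFinite _)).trans ?_
  rw [← Set.image_univ]
  exact (Set.ncard_image_le (Set.toFinite _)).trans (by simp [Set.ncard_univ])

theorem whitePendants_insert_subset (B : Set (Fin n ⊕ (Σ i : Fin n, Fin (d i)))) (z : Fin n)
    (v : Fin n ⊕ (Σ i : Fin n, Fin (d i))) :
    whitePendants (insert v B) z ⊆ whitePendants B z :=
  fun _ h => ⟨h.1, fun h' => h.2 (Or.inr h')⟩

/-- Once all cycle vertices are blue, and white vertices remain at two cycle vertices only. -/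
theorem blueWins_of_two_centres (N : ℕ) : ∀ (B : Set (Fin n ⊕ (Σ i : Fin n, Fin (d i)))) (T : ℕ)
    (z₁ z₂ : Fin n), Bᶜ.ncard = N → (∀ i, Sum.inl i ∈ B) →
    (∀ l, Sum.inr l ∉ B → l.1 = z₁ ∨ l.1 = z₂) →
    ((whitePendants B z₁).ncard - 1) + ((whitePendants B z₂).ncard - 1) ≤ T →
    BlueWins (caterpillarCycle n d) 2 B T := by
  induction N using Nat.strong_induction_on with
  | _ N ih =>
  intro B T z₁ z₂ hN hcyc hcen hT
  by_cases hB : B = Set.univ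
  · rw [hB]; exact .done T
  obtain ⟨p, hp⟩ : ∃ p, Sum.inr p ∉ B := by
    by_contra! h
    refine hB (Set.eq_univ_of_forall ?_)
    rintro (i | l)
    exacts [hcyc i, h l]
  have hle : ∀ z, (whitePendants (insert (.inr p) B) z).ncard ≤ (whitePendants B z).ncard :=
    fun z => Set.ncard_le_ncard (whitePendants_insert_subset B z _) (Set.toFinite _)
  have hlt : (whitePendants (insert (.inr p) B) p.1).ncard < (whitePendants B p.1).ncard := by
    refine Set.ncard_lt_ncard ⟨whitePendants_insert_subset B _ _, fun h => ?_⟩ (Set.toFinite _)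
    exact (h ⟨rfl, hp⟩ : p ∈ whitePendants (insert (.inr p) B) p.1).2 (Or.inl rfl)
  have next : ∀ T', ((whitePendants (insert (.inr p) B) z₁).ncard - 1) +
      ((whitePendants (insert (.inr p) B) z₂).ncard - 1) ≤ T' →
      BlueWins (caterpillarCycle n d) 2 (insert (.inr p) B) T' := fun T' hT' =>
    ih _ (hN ▸ ncard_compl_insert_lt hp) _ T' z₁ z₂ rfl (fun i => Or.inr (hcyc i))
      (fun l hl => hcen l fun h => hl (Or.inr h)) hT'
  have h1 := hle z₁
  have h2 := hle z₂
  by_cases hone : (whitePendants B p.1).ncard ≤ 1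
  · refine .force B T (.inl p.1) (.inr p) ⟨hcyc _, ⟨trivial, hp⟩, rfl, ?_⟩ (next T (by omega))
    rintro (i | l) ⟨-, hx⟩ hadj
    · exact absurd (hcyc i) hx
    · rw [Set.ncard_le_one] at hone
      rw [hone l ⟨hadj, hx⟩ p ⟨rfl, hp⟩]
  -- At least two white pendants remain at `p.1`, so colouring one lowers the truncated sum and pays
  -- for the token.
  · have hz : (whitePendants (insert (.inr p) B) z₁).ncard - 1 +
        ((whitePendants (insert (.inr p) B) z₂).ncard - 1) + 1 ≤ T := by
      rcases hcen p hp with h | h <;> rw [h] at hlt hone <;> omega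
    obtain ⟨T', rfl⟩ : ∃ T', T = T' + 1 := ⟨T - 1, by omega⟩
    exact .token B T' _ hp (next T' (by omega))

/-- Once all cycle vertices are blue, `2 * (k - 1)` tokens are enough. -/
theorem blueWins_of_cycle_blue {k : ℕ} (hd : ∀ i, d i ≤ k) {T : ℕ} (hT : 2 * (k - 1) ≤ T)
    (N : ℕ) : ∀ (B : Set (Fin n ⊕ (Σ i : Fin n, Fin (d i)))), Bᶜ.ncard = N →
    (∀ i, Sum.inl i ∈ B) → BlueWins (caterpillarCycle n d) 2 B T := by
  induction N using Nat.strong_induction_on with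
  | _ N ih =>
  intro B hN hcyc
  by_cases h3 : ∃ p : Fin 3 → (Σ i : Fin n, Fin (d i)), (∀ i, Sum.inr (p i) ∉ B) ∧
      Function.Injective fun i => (p i).1
  · obtain ⟨p, hp, hinj⟩ := h3
    refine blueWins_of_three id ?_ (fun i => .inr (p i)) hp ?_ ?_
    · rintro (i | l) hx (j | m) hy hadj
      · exact absurd (hcyc i) hx
      · exact absurd (hcyc i) hx
      · exact absurd (hcyc j) hy
      · exact hadj.elim
    · intro i j h
      exact hinj (congrArg centre h)
    · rintro S ⟨i, hi⟩
      refine ⟨i, hi, .inl (p i).1, hcyc _, .inr (p i), hp i, rfl, SimpleGraph.Reachable.refl _,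
        ?_, ih _ (hN ▸ ncard_compl_insert_lt (hp i)) _ rfl fun i => Or.inr (hcyc i)⟩
      rintro j hj x hx hadj rfl
      obtain rfl : j = i := hinj hadj
      rfl
  · by_cases hB : B = Set.univ
    · rw [hB]; exact .done T
    obtain ⟨p, hp⟩ : ∃ p, Sum.inr p ∉ B := by
      by_contra! h
      refine hB (Set.eq_univ_of_forall ?_)
      rintro (i | l)
      exacts [hcyc i, h l]
    have hcard : ∀ z, (whitePendants B z).ncard ≤ k := fun z =>
      (ncard_whitePendants_le B z).trans (hd z)
    have two : ∀ z₁ z₂, (∀ l, Sum.inr l ∉ B → l.1 = z₁ ∨ l.1 = z₂) →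
        BlueWins (caterpillarCycle n d) 2 B T := fun z₁ z₂ hz =>
      blueWins_of_two_centres _ B T z₁ z₂ rfl hcyc hz (by
        have := hcard z₁
        have := hcard z₂
        omega)
    by_cases hq : ∃ q, Sum.inr q ∉ B ∧ q.1 ≠ p.1
    · obtain ⟨q, hq, hqp⟩ := hq
      refine two p.1 q.1 fun l hl => ?_
      by_contra! hne
      refine h3 ⟨![p, q, l], ?_, ?_⟩
      · intro i
        fin_cases i
        exacts [hp, hq, hl]
      · intro i j hij
        fin_cases i <;> fin_cases j <;> first
          | rfl
          | exact absurd hij hqp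
          | exact absurd hij hqp.symm
          | exact absurd hij hne.1
          | exact absurd hij hne.1.symm
          | exact absurd hij hne.2
          | exact absurd hij hne.2.symm
    · push Not at hq
      exact two p.1 p.1 fun l hl => Or.inl (hq l hl)

/-- The white cycle vertices form two arcs, with offsets `0 ≤ j < a` and `a + m ≤ j < a + m + b`
from `s`. -/
structure TwoArcs [NeZero n] (B : Set (Fin n ⊕ (Σ i : Fin n, Fin (d i)))) (s a m b : ℕ) :
    Prop where
  pos : 1 ≤ m
  -- The outer gap keeps at least two blue vertices, so the arcs have different outer neighbours;
  -- the middle gap may be a single vertex.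
  le : a + m + b + 2 ≤ n
  white : ∀ j < n, Sum.inl (vtx n (s + j)) ∉ B ↔ j < a ∨ (a + m ≤ j ∧ j < a + m + b)

variable [NeZero n] {B : Set (Fin n ⊕ (Σ i : Fin n, Fin (d i)))} {s a m b : ℕ}

theorem inl_vtx_mem_insert {i j : ℕ} (hi : i < n) (hj : j < n) :
    Sum.inl (vtx n (s + i)) ∈ insert (Sum.inl (vtx n (s + j))) B ↔
      i = j ∨ Sum.inl (vtx n (s + i)) ∈ B := by
  rw [Set.mem_insert_iff, Sum.inl.injEq, vtx_add_inj hi hj]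

theorem vtx_shift (s : ℕ) {c j : ℕ} (h : n ≤ c + j) :
    vtx n (s + c + j) = vtx n (s + (c + j - n)) := by
  rw [← vtx_add_self (s + (c + j - n))]
  congr 1
  omega

theorem TwoArcs.insert_first (h : TwoArcs B s (a + 1) m b) :
    TwoArcs (insert (.inl (vtx n s)) B) (s + 1) a m b where
  pos := h.pos
  le := by have := h.le; omega
  white := by
    intro j hj
    have hle := h.le
    by_cases hj' : 1 + j < n
    · have h1 := inl_vtx_mem_insert (B := B) (s := s) hj' (j := 0) (by omega)
      have h2 := h.white (1 + j) hj'
      rw [add_zero] at h1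
      rw [add_assoc, h1, not_or, h2]
      omega
    -- Offset `n - 1` from `s + 1` wraps around to the vertex just coloured.
    · rw [vtx_shift s (by omega), show 1 + j - n = 0 by omega, add_zero]
      simp
      omega

theorem TwoArcs.insert_last (h : TwoArcs B s (a + 1) m b) :
    TwoArcs (insert (.inl (vtx n (s + a))) B) s a (m + 1) b where
  pos := by omega
  le := by have := h.le; omega
  white := by
    intro j hj
    have hle := h.le
    rw [inl_vtx_mem_insert hj (by omega), not_or, h.white j hj]
    omega

theorem TwoArcs.insert_first' (h : TwoArcs B s a m (b + 1)) :
    TwoArcs (insert (.inl (vtx n (s + (a + m)))) B) s a (m + 1) b where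
  pos := by omega
  le := by have := h.le; omega
  white := by
    intro j hj
    have hle := h.le
    rw [inl_vtx_mem_insert hj (by omega), not_or, h.white j hj]
    omega

theorem TwoArcs.insert_last' (h : TwoArcs B s a m (b + 1)) :
    TwoArcs (insert (.inl (vtx n (s + (a + m + b)))) B) s a m b where
  pos := h.pos
  le := by have := h.le; omega
  white := by
    intro j hj
    have hle := h.le
    have := h.pos
    rw [inl_vtx_mem_insert hj (by omega), not_or, h.white j hj]
    omega

theorem TwoArcs.insert_pendant (h : TwoArcs B s a m b) (p : Σ i : Fin n, Fin (d i)) :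
    TwoArcs (insert (.inr p) B) s a m b where
  pos := h.pos
  le := h.le
  white := by simpa using h.white

/-- While both arcs are nonempty, Blue makes progress for free. -/
theorem TwoArcs.progress (hn : 3 ≤ n) {T : ℕ} (h : TwoArcs B s (a + 1) m (b + 1))
    (hnext : ∀ w ∉ B, (w = .inl (vtx n s) ∨ w = .inl (vtx n (s + a)) ∨
      w = .inl (vtx n (s + (a + 1 + m))) ∨ w = .inl (vtx n (s + (a + 1 + m + b))) ∨
      ∃ p, w = .inr p) → BlueWins (caterpillarCycle n d) 2 (insert w B) T) :
    BlueWins (caterpillarCycle n d) 2 B T := by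
  classical
  have hle := h.le
  have hpos := h.pos
  have hwhite := h.white
  have hblue : ∀ j < n, Sum.inl (vtx n (s + j)) ∈ B ↔
      ¬ (j < a + 1 ∨ (a + 1 + m ≤ j ∧ j < a + 1 + m + (b + 1))) := fun j hj => by
    rw [← hwhite j hj, not_not]
  have hadj : ∀ i j, i < n → j < n → _ := fun i j hi hj => cycleGraph_adj_vtx hn (s := s) hi hj
  have hcyc : ∀ i < n, ∀ x, x ∉ B →
      (caterpillarCycle n d).Adj (.inl (vtx n (s + i))) x → (∃ j' < n, x = .inl (vtx n (s + j')) ∧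
        (j' < a + 1 ∨ (a + 1 + m ≤ j' ∧ j' < a + 1 + m + (b + 1))) ∧
        (j' = i + 1 ∨ i = j' + 1 ∨ (i = 0 ∧ j' + 1 = n) ∨ (j' = 0 ∧ i + 1 = n))) ∨
        ∃ l, x = .inr l ∧ l.1 = vtx n (s + i) := by
    rintro i hi (x | l) hx hvx
    · obtain ⟨j', hj', rfl⟩ := exists_vtx s x
      exact Or.inl ⟨j', hj', rfl, (hwhite j' hj').1 hx, (hadj i j' hi hj').1 hvx⟩
    · exact Or.inr ⟨l, rfl, hvx⟩
  have hs0 : Sum.inl (vtx n s) ∉ B := (hwhite 0 (by omega)).2 (by omega)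
  by_cases hp : ∃ p, Sum.inr p ∉ B ∧ Sum.inl p.1 ∈ B
  swap
  · push Not at hp
    -- No blue cycle vertex has a white pendant, so the outer neighbour of the first arc can force
    -- by Rule 2.
    refine .force B T (.inl (vtx n (s + (n - 1)))) (.inl (vtx n s))
      ⟨(hblue _ (by omega)).2 (by omega), ⟨trivial, hs0⟩,
        (hadj (n - 1) 0 (by omega) (by omega)).2 (by omega), ?_⟩ (hnext _ hs0 (Or.inl rfl))
    rintro x ⟨-, hx⟩ hvx
    obtain ⟨j', hj', rfl, h1, h2⟩ | ⟨l, rfl, hl⟩ := hcyc _ (by omega) x hx hvx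
    · obtain rfl : j' = 0 := by omega
      rfl
    · refine absurd ((hblue (n - 1) (by omega)).2 (by omega)) ?_
      rw [← hl]
      exact hp l hx
  obtain ⟨p, hp, hpB⟩ := hp
  choose off hoff hoff' using fun x : Fin n => exists_vtx s x
  have hoff_vtx : ∀ j < n, off (vtx n (s + j)) = j := fun j hj =>
    ((vtx_add_inj hj (hoff _)).1 (hoff' _)).symm
  -- Labels `0` and `1` mark the two arcs with their pendants, `2` marks `p`, and `3` marks the
  -- other pendants at blue centres, which are never selected.
  let lab : Fin n ⊕ (Σ i : Fin n, Fin (d i)) → ℕ := fun v =>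
    if Sum.inl (centre v) ∉ B then (if off (centre v) < a + 1 then 0 else 1)
    else if v = .inr p then 2 else 3
  have lab_centre : ∀ v, ∀ j < n, centre v = vtx n (s + j) → Sum.inl (vtx n (s + j)) ∉ B →
      lab v = if j < a + 1 then 0 else 1 := fun v j hj hc hw => by
    simp only [lab, hc, hw, not_false_eq_true, if_true, hoff_vtx j hj]
  have lab_vtx : ∀ j < n, Sum.inl (vtx n (s + j)) ∉ B →
      lab (.inl (vtx n (s + j))) = if j < a + 1 then 0 else 1 := fun j hj hw =>
    lab_centre _ j hj rfl hw
  have lab_p : lab (.inr p) = 2 := by simp [lab, hpB]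
  have lab_pendant : ∀ l, Sum.inl l.1 ∈ B → lab (.inr l) < 3 → l = p := by
    intro l hl hlt
    by_contra hne
    simp [lab, hl, hne] at hlt
  have hy1 : Sum.inl (vtx n (s + (a + 1 + m))) ∉ B := (hwhite _ (by omega)).2 (by omega)
  have lab0 : lab (.inl (vtx n s)) = 0 := by simpa using lab_vtx 0 (by omega) hs0
  have lab1 : lab (.inl (vtx n (s + (a + 1 + m)))) = 1 := by
    rw [lab_vtx _ (by omega) hy1, if_neg (by omega)]
  have hy : ∀ i, (![.inl (vtx n s), .inl (vtx n (s + (a + 1 + m))), .inr p] :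
      Fin 3 → Fin n ⊕ (Σ i : Fin n, Fin (d i))) i ∉ B := by
    intro i
    fin_cases i
    exacts [hs0, hy1, hp]
  have reach0 : ∀ j < a + 1, ∀ hw : Sum.inl (vtx n (s + j)) ∉ B,
      ((caterpillarCycle n d).induce Bᶜ).Reachable ⟨_, hs0⟩ ⟨_, hw⟩ := fun j hj hw =>
    reachable_path hn (P := Bᶜ) (s := s) (L := a)
      (fun j hj => (hwhite j (by omega)).2 (by omega)) (by omega)
  have reach1 : ∀ j < b + 1, ∀ hw : Sum.inl (vtx n (s + (a + 1 + m + j))) ∉ B,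
      ((caterpillarCycle n d).induce Bᶜ).Reachable ⟨_, hy1⟩ ⟨_, hw⟩ := by
    intro j hj hw
    have := reachable_path hn (P := Bᶜ) (s := s + (a + 1 + m)) (L := b)
      (fun j hj => by
        rw [add_assoc]
        exact (hwhite _ (by omega)).2 (by omega)) (j := j) (by omega)
    simpa only [add_assoc, add_zero] using this
  refine blueWins_of_three lab ?_ _ hy ?_ ?_
  · rintro (x | l) hx (y | l') hy hxy
    · obtain ⟨i, hi, rfl⟩ := exists_vtx s x
      obtain ⟨j, hj, rfl⟩ := exists_vtx s y
      rw [lab_vtx i hi hx, lab_vtx j hj hy]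
      have h1 := (hwhite i hi).1 hx
      have h2 := (hwhite j hj).1 hy
      have h3 := (hadj i j hi hj).1 hxy
      split_ifs <;> first | rfl | omega
    · obtain ⟨i, hi, rfl⟩ := exists_vtx s x
      rw [lab_vtx i hi hx, lab_centre (.inr l') i hi hxy hx]
    · obtain ⟨i, hi, rfl⟩ := exists_vtx s y
      rw [lab_vtx i hi hy, lab_centre (.inr l) i hi hxy hy]
    · exact absurd hxy not_adj_inr_inr
  · intro i j hij
    fin_cases i <;> fin_cases j <;> simp [lab0, lab1, lab_p] at hij ⊢
  intro S hS
  -- A force from cycle vertex `i` into arc vertex `j` is legal once `j` is the only visible white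
  -- cycle neighbour of `i` and `p`, if visible, is not attached to `i`.
  have move : ∀ e ∈ S, ∀ i j : ℕ, i < n → j < n → Sum.inl (vtx n (s + i)) ∈ B →
      ∀ hj : Sum.inl (vtx n (s + j)) ∉ B,
      (j = i + 1 ∨ i = j + 1 ∨ (i = 0 ∧ j + 1 = n) ∨ (j = 0 ∧ i + 1 = n)) →
      ((caterpillarCycle n d).induce Bᶜ).Reachable ⟨_, hy e⟩ ⟨_, hj⟩ →
      (∀ j' < n, (j' < a + 1 ∨ (a + 1 + m ≤ j' ∧ j' < a + 1 + m + (b + 1))) →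
        (j' = i + 1 ∨ i = j' + 1 ∨ (i = 0 ∧ j' + 1 = n) ∨ (j' = 0 ∧ i + 1 = n)) →
        (j' < a + 1 → 0 ∈ S) → (¬ j' < a + 1 → 1 ∈ S) → j' = j) →
      (2 ∈ S → p.1 ≠ vtx n (s + i)) →
      BlueWins (caterpillarCycle n d) 2 (insert (.inl (vtx n (s + j))) B) T →
      ∃ e ∈ S, ∃ v ∈ B, ∃ w, ∃ hw : w ∉ B, (caterpillarCycle n d).Adj v w ∧
      ((caterpillarCycle n d).induce Bᶜ).Reachable ⟨_, hy e⟩ ⟨w, hw⟩ ∧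
      (∀ f ∈ S, ∀ x ∉ B, (caterpillarCycle n d).Adj v x → lab x = lab
        ((![.inl (vtx n s), .inl (vtx n (s + (a + 1 + m))), .inr p] :
          Fin 3 → Fin n ⊕ (Σ i : Fin n, Fin (d i))) f) → x = w) ∧
      BlueWins (caterpillarCycle n d) 2 (insert w B) T := by
    intro e he i j hi hj hiB hjB hij hr huniq hpS hwin
    refine ⟨e, he, _, hiB, _, hjB, (hadj i j hi hj).2 hij, hr, ?_, hwin⟩
    intro f hf x hx hvx hlab
    obtain ⟨j', hj', rfl, h1, h2⟩ | ⟨l, rfl, hl⟩ := hcyc _ hi x hx hvx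
    · rw [lab_vtx j' hj' hx] at hlab
      rw [huniq j' hj' h1 h2]
      · intro hlt
        fin_cases f <;> simp [lab0, lab1, lab_p, hlt] at hlab
        exact hf
      · intro hlt
        fin_cases f <;> simp [lab0, lab1, lab_p, hlt] at hlab
        exact hf
    · have hlB : Sum.inl l.1 ∈ B := hl ▸ hiB
      have hlt : lab (.inr l) < 3 := by
        rw [hlab]
        fin_cases f <;> simp [lab0, lab1, lab_p]
      obtain rfl := lab_pendant l hlB hlt
      refine absurd hl (hpS ?_)
      fin_cases f <;> simp [lab0, lab1, lab_p] at hlab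
      exact hf
  have move_first : 0 ∈ S → (2 ∈ S → p.1 ≠ vtx n (s + (n - 1))) → _ := fun h0 h2 =>
    move 0 h0 (n - 1) 0 (by omega) (by omega) ((hblue _ (by omega)).2 (by omega)) hs0 (by omega)
      (SimpleGraph.Reachable.refl _) (fun j' _ _ _ _ _ => by omega) h2 (hnext _ hs0 (Or.inl rfl))
  have hya : Sum.inl (vtx n (s + a)) ∉ B := (hwhite _ (by omega)).2 (by omega)
  have hyb : Sum.inl (vtx n (s + (a + 1 + m + b))) ∉ B := (hwhite _ (by omega)).2 (by omega)
  have move_last : 0 ∈ S → 1 ∉ S → (2 ∈ S → p.1 ≠ vtx n (s + (a + 1))) → _ := fun h0 h1 h2 =>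
    move 0 h0 (a + 1) a (by omega) (by omega) ((hblue _ (by omega)).2 (by omega)) hya (by omega)
      (reach0 a (by omega) hya) (fun j' _ _ _ _ h1' => by
        by_cases hj' : j' < a + 1
        · omega
        · exact absurd (h1' hj') h1) h2 (hnext _ hya (by simp))
  have move_first' : 1 ∈ S → 0 ∉ S → (2 ∈ S → p.1 ≠ vtx n (s + (a + m))) → _ := fun h1 h0 h2 =>
    move 1 h1 (a + m) (a + 1 + m) (by omega) (by omega) ((hblue _ (by omega)).2 (by omega)) hy1
      (by omega) (SimpleGraph.Reachable.refl _) (fun j' _ _ _ h0' _ => by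
        by_cases hj' : j' < a + 1
        · exact absurd (h0' hj') h0
        · omega) h2 (hnext _ hy1 (by simp))
  have move_last' : 1 ∈ S → (2 ∈ S → p.1 ≠ vtx n (s + (a + 1 + m + b + 1))) → _ := fun h1 h2 =>
    move 1 h1 (a + 1 + m + b + 1) (a + 1 + m + b) (by omega) (by omega)
      ((hblue _ (by omega)).2 (by omega)) hyb (by omega) (reach1 b (by omega) hyb)
      (fun j' _ _ _ _ _ => by omega) h2 (hnext _ hyb (by simp))
  have hne : ∀ i j, i < n → j < n → i ≠ j → p.1 = vtx n (s + i) → p.1 ≠ vtx n (s + j) := by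
    intro i j hi hj hij h1 h2
    rw [h1, vtx_add_inj hi hj] at h2
    exact hij h2
  -- Blue enters an answered arc from its outer neighbour. Only `p` can obstruct this; then it
  -- obstructs no other vertex, so Blue uses the other arc's outer neighbour, or the inner one if
  -- the other arc was not answered.
  by_cases h0 : 0 ∈ S
  · by_cases hz : 2 ∈ S → p.1 ≠ vtx n (s + (n - 1))
    · exact move_first h0 hz
    push Not at hz
    by_cases h1 : 1 ∈ S
    · exact move_last' h1 fun _ => hne _ _ (by omega) (by omega) (by omega) hz.2
    · exact move_last h0 h1 fun _ => hne _ _ (by omega) (by omega) (by omega) hz.2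
  · by_cases h1 : 1 ∈ S
    · by_cases hz : 2 ∈ S → p.1 ≠ vtx n (s + (a + 1 + m + b + 1))
      · exact move_last' h1 hz
      push Not at hz
      exact move_first' h1 h0 fun _ => hne _ _ (by omega) (by omega) (by omega) hz.2
    · have h2 : 2 ∈ S := by
        obtain ⟨e, he⟩ := hS
        fin_cases e
        exacts [absurd he h0, absurd he h1, he]
      refine ⟨2, h2, .inl p.1, hpB, .inr p, hp, rfl, SimpleGraph.Reachable.refl _, ?_,
        hnext _ hp (by simp)⟩
      intro f hf x hx hvx hlab
      obtain rfl : f = 2 := by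
        fin_cases f
        exacts [absurd hf h0, absurd hf h1, rfl]
      rcases x with x | l
      · have : lab (.inl x) ≤ 1 := by
          obtain ⟨i, hi, rfl⟩ := exists_vtx s x
          rw [lab_vtx i hi hx]
          split_ifs <;> omega
        rw [hlab] at this
        simp [lab_p] at this
      · have hl : l.1 = p.1 := hvx
        rw [lab_pendant l (hl ▸ hpB) (by rw [hlab]; simp [lab_p])]

/-- Here `t` is the budget for halvings and `2 * (k - 1)` is reserved for the final pendants. The
induction is on the number of white vertices, as free moves leave `t` unchanged. -/
theorem TwoArcs.blueWins (hn : 3 ≤ n) {k : ℕ} (hd : ∀ i, d i ≤ k) (N : ℕ) :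
    ∀ (B : Set (Fin n ⊕ (Σ i : Fin n, Fin (d i)))) (t s a m b : ℕ), Bᶜ.ncard = N →
    TwoArcs B s a m b → a < 2 ^ t → b < 2 ^ t →
    BlueWins (caterpillarCycle n d) 2 B (t + 2 * (k - 1)) := by
  induction N using Nat.strong_induction_on with
  | _ N ih =>
  intro B t s a m b hN h ha hb
  have ih' : ∀ w ∉ B, ∀ t s a m b, TwoArcs (insert w B) s a m b → a < 2 ^ t → b < 2 ^ t →
      BlueWins (caterpillarCycle n d) 2 (insert w B) (t + 2 * (k - 1)) := fun w hw t s a m b =>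
    ih _ (hN ▸ ncard_compl_insert_lt hw) _ t s a m b rfl
  have hle := h.le
  have hpos := h.pos
  -- With a single arc left, a token at its middle gives two arcs shorter than `2 ^ (t - 1)`; if the
  -- arc is empty, the cycle is blue.
  have one : ∀ s b, b + 2 ≤ n → b < 2 ^ t →
      (∀ j < n, Sum.inl (vtx n (s + j)) ∉ B ↔ j < b) →
      BlueWins (caterpillarCycle n d) 2 B (t + 2 * (k - 1)) := by
    intro s b hbn hbt hw
    rcases Nat.eq_zero_or_pos b with rfl | hb0
    · refine blueWins_of_cycle_blue hd (by omega) _ B rfl fun i => ?_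
      obtain ⟨j, hj, rfl⟩ := exists_vtx s i
      by_contra hi
      have := (hw j hj).1 hi
      omega
    · obtain ⟨t, rfl⟩ : ∃ t', t = t' + 1 := by
        cases t with
        | zero => simp at hbt; omega
        | succ t => exact ⟨t, rfl⟩
      have hpow : 2 ^ (t + 1) = 2 * 2 ^ t := by ring
      rw [show t + 1 + 2 * (k - 1) = t + 2 * (k - 1) + 1 by ring]
      have hwB : Sum.inl (vtx n (s + (b - 1) / 2)) ∉ B := (hw _ (by omega)).2 (by omega)
      refine .token B _ _ hwB (ih' _ hwB t s ((b - 1) / 2) 1 (b - 1 - (b - 1) / 2) ⟨le_rfl,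
        by omega, fun j hj => ?_⟩ (by omega) (by omega))
      rw [inl_vtx_mem_insert hj (by omega), not_or, hw j hj]
      omega
  rcases a with - | a
  · refine one (s + m) b (by omega) hb fun j hj => ?_
    by_cases hj' : m + j < n
    · rw [add_assoc, h.white _ hj']
      omega
    · rw [vtx_shift s (by omega), h.white _ (by omega)]
      omega
  rcases b with - | b
  · refine one s (a + 1) (by omega) ha fun j hj => ?_
    rw [h.white j hj]
    omega
  refine h.progress hn ?_
  rintro w hw (rfl | rfl | rfl | rfl | ⟨p, rfl⟩)
  · exact ih' _ hw _ _ _ _ _ h.insert_first (by omega) hb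
  · exact ih' _ hw _ _ _ _ _ h.insert_last (by omega) hb
  · exact ih' _ hw _ _ _ _ _ h.insert_first' ha (by omega)
  · exact ih' _ hw _ _ _ _ _ h.insert_last' ha (by omega)
  · exact ih' _ hw _ _ _ _ _ (h.insert_pendant p) ha hb

theorem blueWins_empty (hn : 3 ≤ n) {k : ℕ} (hk : 1 ≤ k) (hd : ∀ i, d i ≤ k) :
    BlueWins (caterpillarCycle n d) 2 ∅ (Nat.log 2 (n - 2) + 2 * k + 1) := by
  have hlog := Nat.lt_pow_succ_log_self (b := 2) one_lt_two (n - 2)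
  have hpow : 2 ^ (Nat.log 2 (n - 2) + 1) = 2 * 2 ^ Nat.log 2 (n - 2) := by ring
  have hmem : ∀ {i j : ℕ} {B : Set (Fin n ⊕ (Σ i : Fin n, Fin (d i)))}, i < n → j < n → _ :=
    fun {i j B} hi hj => inl_vtx_mem_insert (B := B) (s := 0) (i := i) (j := j) hi hj
  rw [show Nat.log 2 (n - 2) + 2 * k + 1 = Nat.log 2 (n - 2) + 2 * (k - 1) + 1 + 1 + 1 by omega]
  -- Two adjacent tokens create the outer gap, and the third bisects the remaining path of `n - 2`
  -- cycle vertices.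
  refine .token _ _ (.inl (vtx n (0 + (n - 1)))) (by simp) (.token _ _
    (.inl (vtx n (0 + (n - 2)))) ?_ (.token _ _ (.inl (vtx n (0 + (n - 3) / 2))) ?_
    (TwoArcs.blueWins hn hd _ _ _ 0 ((n - 3) / 2) 1 (n - 3 - (n - 3) / 2) rfl
      ⟨le_rfl, by omega, fun j hj => ?_⟩ (by omega) (by omega))))
  · rw [hmem (by omega) (by omega)]
    simp
    omega
  · rw [hmem (by omega) (by omega), hmem (by omega) (by omega)]
    simp
    omega
  · rw [hmem hj (by omega), hmem hj (by omega), hmem hj (by omega)]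
    simp only [Set.mem_empty_iff_false, or_false]
    omega

end BlueStrategy
end QForcing

theorem theorem4p9 (n k : ℕ) (hn : 3 ≤ n) (hk : 2 ≤ k) (d : Fin n → ℕ)
    (hd : ∀ i, 2 ≤ d i ∧ d i ≤ k) :
    Real.logb 2 (n : ℝ) + 1 ≤ (QForcing.forcingNumber (QForcing.caterpillarCycle n d) 2 : ℝ) ∧
    (QForcing.forcingNumber (QForcing.caterpillarCycle n d) 2 : ℝ) ≤
      Real.logb 2 ((n : ℝ) - 2) + 2 * (k : ℝ) + 1 := by
  have : NeZero n := ⟨by omega⟩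
  have hwin := QForcing.blueWins_empty hn (by omega : 1 ≤ k) (fun i => (hd i).2)
  constructor
  -- `hwin` makes the set nonempty, so the infimum is attained and is not the default value `0`.
  · have hmem := Nat.sInf_mem (s := {t | QForcing.BlueWins (QForcing.caterpillarCycle n d) 2 ∅ t})
      ⟨_, hwin⟩
    obtain ⟨t, ht, hnt⟩ := QForcing.lt_of_blueWins_empty hn (fun i => (hd i).1) hmem
    rw [QForcing.forcingNumber, ht]
    push_cast
    gcongr
    rw [Real.logb_le_iff_le_rpow one_lt_two (by positivity), Real.rpow_natCast]
    exact_mod_cast hnt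
  · have hle : QForcing.forcingNumber (QForcing.caterpillarCycle n d) 2 ≤ _ := Nat.sInf_le hwin
    have hlog := Real.natLog_le_logb (n - 2) 2
    rw [Nat.cast_sub (by omega)] at hlog
    push_cast at hlog
    have hle' : (QForcing.forcingNumber (QForcing.caterpillarCycle n d) 2 : ℝ) ≤
        Nat.log 2 (n - 2) + 2 * k + 1 := by exact_mod_cast hle
    linarith
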